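/- Let $G$ be a finite group and let $p$ be a prime. For a finite group $K$ put \[ \varphi(K)=|\{g\in K : o(g)=\exp(K)\}|, \] where $o(g)$ is the order of $g$ and $\exp(K)$ the exponent of $K$. Let $O_{p'}(K)$ denote the largest normal subgroup of $K$ of order prime to $p$, and $O_p(K)$ the largest normal $p$-subgroup of $K$; $K$ is called $p'$-reduced if $O_{p'}(K)=1$, and $p$-reduced if $O_p(K)=1$. A section of a group is a quotient $H/N$ of a subgroup $H$ by a normal subgroup $N$ of $H$. $G$ is $p$-nilpotent if it has a normal $p$-complement, that is, a normal subgroup that is a complement in $G$ to the Sylow $p$-subgroups of $G$. A $p$-subgroup $Q\le G$ is $p$-centric if its center $Z(Q)$ is a Sylow $p$-subgroup of the centralizer $C_G(Q)$, and $p$-radical if $N_G(Q)/Q$ is $p$-reduced. Then the following are equivalent: 1. $G$ is $p$-nilpotent. 2. $\varphi(K)\neq 0$ for each $p'$-reduced section $K$ of $G$. 3. $\varphi(K)\neq 0$ for each $p'$-reduced section $K$ of $N_G(Q)$, for every $p$-centric $p$-subgroup $Q$ of $G$. 4. $\varphi(K)\neq 0$ for each $p'$-reduced section $K$ of $N_G(Q)$,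 for every $p$-subgroup $Q$ of $G$ that is both $p$-centric and $p$-radical. -/

import Mathlib

/-- The number `φ(G)` of elements of `G` whose order equals the exponent of `G`. -/
noncomputable def expOrderCount (G : Type*) [Group G] : ℕ :=
  Nat.card {g : G // orderOf g = Monoid.exponent G}

/-- `O_{p'}(G)`: the largest normal subgroup of `G` of order prime to `p`, as the join of all
normal subgroups of order prime to `p` (see `isGreatest_pPrimeCore`). -/
def pPrimeCore (p : ℕ) (G : Type*) [Group G] : Subgroup G :=
  sSup {N : Subgroup G | N.Normal ∧ (Nat.card N).Coprime p}

/-- `O_p(G)`: the largest normal `p`-subgroup of `G`, as the join of all normal `p`-subgroups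
(see `isGreatest_pCore`). -/
def pCore (p : ℕ) (G : Type*) [Group G] : Subgroup G :=
  sSup {N : Subgroup G | N.Normal ∧ IsPGroup p N}

theorem isGreatest_sSup_of_sup {G : Type*} [Group G] [Finite G] {s : Set (Subgroup G)}
    (hbot : ⊥ ∈ s) (hsup : ∀ M ∈ s, ∀ N ∈ s, M ⊔ N ∈ s) : IsGreatest s (sSup s) := by
  refine ⟨?_, fun _ hM => le_sSup hM⟩
  obtain ⟨N, hN⟩ := (Set.toFinite s).exists_maximal ⟨⊥, hbot⟩
  have hg : sSup s = N := by
    refine le_antisymm (sSup_le fun M hM => ?_) (le_sSup hN.1)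
    exact le_sup_left.trans (hN.2 (hsup M hM N hN.1) le_sup_right)
  rw [hg]
  exact hN.1

theorem isGreatest_pPrimeCore (p : ℕ) (G : Type*) [Group G] [Finite G] :
    IsGreatest {N : Subgroup G | N.Normal ∧ (Nat.card N).Coprime p} (pPrimeCore p G) := by
  refine isGreatest_sSup_of_sup ⟨inferInstance, by simp⟩ ?_
  rintro M ⟨hM, hMp⟩ N ⟨hN, hNp⟩
  refine ⟨inferInstance, ?_⟩
  have h : Nat.card (M ⊔ N : Subgroup G) = Nat.card M * M.relIndex (M ⊔ N) :=
    by simpa using (Subgroup.relIndex_mul_relIndex ⊥ M (M ⊔ N) bot_le le_sup_left).symm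
  have h2 : M.relIndex (M ⊔ N) ∣ Nat.card N := by
    rw [sup_comm, Subgroup.relIndex_sup_right]
    exact Subgroup.relIndex_dvd_card M N
  rw [h]
  exact Nat.Coprime.mul_left hMp (Nat.Coprime.coprime_dvd_left h2 hNp)

theorem isGreatest_pCore (p : ℕ) (G : Type*) [Group G] [Finite G] :
    IsGreatest {N : Subgroup G | N.Normal ∧ IsPGroup p N} (pCore p G) := by
  refine isGreatest_sSup_of_sup ⟨inferInstance, IsPGroup.of_bot⟩ ?_
  rintro M ⟨hM, hMp⟩ N ⟨hN, hNp⟩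
  exact ⟨inferInstance, hMp.to_sup_of_normal_right hNp⟩

/-- `G` is `p'`-reduced if `O_{p'}(G) = 1`. -/
def IsPPrimeReduced (p : ℕ) (G : Type*) [Group G] : Prop := pPrimeCore p G = ⊥

/-- `G` is `p`-reduced if `O_p(G) = 1`. -/
def IsPReduced (p : ℕ) (G : Type*) [Group G] : Prop := pCore p G = ⊥

/-- A finite group `G` is `p`-nilpotent if it has a normal `p`-complement, that is, a normal
subgroup which is a complement in `G` to the Sylow `p`-subgroups. -/
def IsPNilpotent (p : ℕ) (G : Type*) [Group G] : Prop :=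
  ∃ N : Subgroup G, N.Normal ∧ ∀ P : Sylow p G, N.IsComplement' (P : Subgroup G)

/-- Every `p'`-reduced section `H ⧸ N` of `G` (`H` a subgroup of `G`, `N` a normal subgroup
of `H`) satisfies `φ(H ⧸ N) ≠ 0`. -/
def ReducedSectionsAttainExponent (p : ℕ) (G : Type*) [Group G] : Prop :=
  ∀ (H : Subgroup G) (N : Subgroup H) [N.Normal],
    IsPPrimeReduced p (H ⧸ N) → expOrderCount (H ⧸ N) ≠ 0

/-- `Q` is `p`-centric in `G` if the center `Z(Q)` is a Sylow `p`-subgroup of the centralizer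
`C_G(Q)`. -/
def IsPCentricSubgroup (p : ℕ) {G : Type*} [Group G] (Q : Subgroup G) : Prop :=
  ∃ S : Sylow p (Subgroup.centralizer (Q : Set G)),
    (S : Subgroup (Subgroup.centralizer (Q : Set G))) =
      ((Subgroup.center Q).map Q.subtype).subgroupOf (Subgroup.centralizer (Q : Set G))

/-- `Q` is `p`-radical in `G` if `N_G(Q) / Q` is `p`-reduced. -/
def IsPRadicalSubgroup (p : ℕ) {G : Type*} [Group G] (Q : Subgroup G) : Prop :=
  IsPReduced p (Subgroup.normalizer (Q : Set G) ⧸ Q.subgroupOf (Subgroup.normalizer (Q : Set G)))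

/-!
Everything is reduced to the local condition that, for each `p`-subgroup `Q` of `G`, the
`p'`-elements of `N_G(Q)` centralize `Q` (`PPrimeElementsCentralize`).

The local condition implies `p`-nilpotency: this is Frobenius' normal `p`-complement theorem
(`PPrimeElementsCentralize.exists_normal_coprime`). It makes any two Sylow `p`-subgroups conjugate
under the centralizer of their intersection, so a Sylow `p`-subgroup `P` controls the fusion of its
elements. The focal subgroup of `P` is therefore its commutator subgroup `[P, P]`, the transfer into
`P ⧸ [P, P]` has a proper kernel
of `p`-power index, and induction applies to that kernel.

If all `p'`-reduced sections attain their exponent, the local condition holds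
(`ReducedSectionsAttainExponent.pPrimeElementsCentralize`). In a minimal counterexample
`G = Q ⟨x⟩`, with `Q` a minimal normal `p`-subgroup and `x` a `p'`-element acting nontrivially on
it, the group `G` is itself `p'`-reduced. The `p`-part of an element of order `exp G` is then a
nontrivial element of `Q`, and it is central because the `p'`-part of that element generates `G`
together with the abelian group `Q`. By minimality `Q` is central, which is absurd.

Finally, it is enough to know this on the normalizers of the centric radical subgroups
(`PPrimeElementsCentralize.of_centric_radical`): a `p`-subgroup `Q` of maximal order violating the
local condition is `p`-radical, since otherwise the preimage of `O_p(N_G(Q) ⧸ Q)` is a larger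
violating one, and is `p`-centric, since otherwise `Q P` is, for `P` a Sylow `p`-subgroup of `C_G(Q)`,
by the Frattini argument.

Conversely, the `p'`-reduced sections of a `p`-nilpotent group are `p`-groups, and these attain their
exponent.
-/

section
open Subgroup

variable {p : ℕ} {G : Type*} [Group G]

/-! ### Elements of order prime to `p` -/

/-- An element of order prime to `p` is a power of its `p ^ k`-th power. -/
theorem mem_of_pow_prime_pow_mem {H : Subgroup G} {x : G} (hx : (orderOf x).Coprime p) {k : ℕ}
    (h : x ^ p ^ k ∈ H) : x ∈ H := by
  have h1 : x ∈ zpowers (x ^ p ^ k) :=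
    mem_zpowers_pow_iff.2 (Nat.Coprime.pow_right k hx).symm
  exact (zpowers_le.2 h) h1

theorem eq_one_of_isPGroup_of_coprime {Q : Subgroup G} (hQ : IsPGroup p Q) {x : G} (hxQ : x ∈ Q)
    (hx : (orderOf x).Coprime p) : x = 1 := by
  obtain ⟨k, hk⟩ := hQ ⟨x, hxQ⟩
  have : x ^ p ^ k = 1 := by simpa using congrArg Subtype.val hk
  exact (Subgroup.mem_bot).1 (mem_of_pow_prime_pow_mem (H := ⊥) hx (Subgroup.mem_bot.2 this))

/-- Frobenius' local condition: every `p'`-element normalizing a `p`-subgroup `Q` of `G` centralizes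
`Q`. For finite `G` this says that all the groups `N_G(Q) ⧸ C_G(Q)` are `p`-groups. -/
def PPrimeElementsCentralize (p : ℕ) (G : Type*) [Group G] : Prop :=
  ∀ Q : Subgroup G, IsPGroup p Q → ∀ x ∈ normalizer (Q : Set G),
    (orderOf x).Coprime p → x ∈ centralizer (Q : Set G)

theorem PPrimeElementsCentralize.of_injective {H : Type*} [Group H]
    (h : PPrimeElementsCentralize p G) (f : H →* G) (hf : Function.Injective f) :
    PPrimeElementsCentralize p H := by
  intro Q hQ x hx hxp
  have := h (Q.map f) (hQ.map f) (f x) (le_normalizer_map f ⟨x, hx, rfl⟩)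
    (by rwa [orderOf_injective f hf])
  rw [mem_centralizer_iff] at this ⊢
  intro y hy
  apply hf
  simpa using this (f y) ⟨y, hy, rfl⟩

/-! ### Sections attaining their exponent -/

theorem expOrderCount_congr {G H : Type*} [Group G] [Group H] (e : G ≃* H) :
    expOrderCount G = expOrderCount H := by
  refine Nat.card_congr (e.toEquiv.subtypeEquiv fun g => ?_)
  rw [← Monoid.exponent_eq_of_mulEquiv e]
  exact (MulEquiv.orderOf_eq e g).symm ▸ Iff.rfl

theorem expOrderCount_ne_zero_iff [Finite G] :
    expOrderCount G ≠ 0 ↔ ∃ g : G, orderOf g = Monoid.exponent G := by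
  rw [expOrderCount, Nat.card_ne_zero, nonempty_subtype]
  exact and_iff_left inferInstance

theorem IsPPrimeReduced.of_mulEquiv {G H : Type*} [Group G] [Group H] [Finite G] [Finite H]
    (h : IsPPrimeReduced p G) (e : G ≃* H) : IsPPrimeReduced p H := by
  have hH := (isGreatest_pPrimeCore p H).1
  have := hH.1
  have h1 : (pPrimeCore p H).map (e.symm : H →* G) ≤ pPrimeCore p G :=
    (isGreatest_pPrimeCore p G).2 ⟨Normal.map inferInstance _ e.symm.surjective, by
      rw [card_map_of_injective e.symm.injective]; exact hH.2⟩
  rw [h, le_bot_iff] at h1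
  exact (map_eq_bot_iff_of_injective _ e.symm.injective).1 h1

/-- The sections of `G` may be taken to be the groups onto which some subgroup of `G` maps. -/
theorem ReducedSectionsAttainExponent.of_surjective_subgroup [Finite G]
    (h : ReducedSectionsAttainExponent p G) {K : Type*} [Group K] {H : Subgroup G} (f : H →* K)
    (hf : Function.Surjective f) (hK : IsPPrimeReduced p K) : expOrderCount K ≠ 0 := by
  have : Finite K := Finite.of_surjective f hf
  let e := QuotientGroup.quotientKerEquivOfSurjective f hf
  rw [← expOrderCount_congr e]
  exact h H f.ker (hK.of_mulEquiv e.symm)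

theorem ReducedSectionsAttainExponent.of_injective [Finite G] {L : Type*} [Group L]
    (h : ReducedSectionsAttainExponent p G) (f : L →* G) (hf : Function.Injective f) :
    ReducedSectionsAttainExponent p L := by
  intro H N _ hred
  let e := H.equivMapOfInjective f hf
  exact h.of_surjective_subgroup ((QuotientGroup.mk' N).comp e.symm.toMonoidHom)
    ((QuotientGroup.mk'_surjective N).comp e.symm.surjective) hred

theorem ReducedSectionsAttainExponent.of_surjective [Finite G] {L : Type*} [Group L]
    (h : ReducedSectionsAttainExponent p G) (f : G →* L) (hf : Function.Surjective f) :
    ReducedSectionsAttainExponent p L := by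
  intro H N _ hred
  exact h.of_surjective_subgroup ((QuotientGroup.mk' N).comp (f.subgroupComap H))
    ((QuotientGroup.mk'_surjective N).comp (f.subgroupComap_surjective_of_surjective H hf)) hred

variable [hp : Fact p.Prime]

theorem IsPGroup.exists_orderOf_eq_exponent [Finite G] (h : IsPGroup p G) :
    ∃ g : G, orderOf g = Monoid.exponent G := by
  obtain ⟨n, hn⟩ := isPGroup_iff_exponent_eq_pow.1 h
  obtain ⟨g, hg⟩ := hp.out.exists_orderOf_eq_pow_factorization_exponent G
  refine ⟨g, hg.trans ?_⟩
  rw [hn, hp.out.factorization_pow, Finsupp.single_eq_same]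

theorem coprime_of_not_dvd {n : ℕ} (h : ¬ p ∣ n) : n.Coprime p :=
  ((Nat.Prime.coprime_iff_not_dvd hp.out).2 h).symm

theorem exists_orderOf_pow_prime_pow_coprime [Finite G] (x : G) :
    ∃ k : ℕ, (orderOf (x ^ p ^ k)).Coprime p := by
  obtain ⟨k, m, hm, h⟩ := Nat.exists_eq_pow_mul_and_not_dvd (orderOf_pos x).ne' p hp.out.ne_one
  refine ⟨k, ?_⟩
  rw [orderOf_pow_of_dvd (pow_ne_zero _ hp.out.ne_zero) (h ▸ dvd_mul_right _ _), h,
    Nat.mul_div_cancel_left _ (pow_pos hp.out.pos k)]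
  exact coprime_of_not_dvd hm

/-- In a `p'`-reduced section of `G` the image of the normal `p`-complement is trivial, so the section
is a `p`-group. -/
theorem IsPNilpotent.reducedSectionsAttainExponent [Finite G] (h : IsPNilpotent p G) :
    ReducedSectionsAttainExponent p G := by
  obtain ⟨K, hKn, hK⟩ := h
  obtain ⟨P⟩ : Nonempty (Sylow p G) := inferInstance
  have hKp : (Nat.card K).Coprime p :=
    coprime_of_not_dvd ((hK P).index_eq_card ▸ P.not_dvd_index)
  obtain ⟨n, hn⟩ := IsPGroup.iff_card.1 P.2
  have hpow (g : G) : g ^ p ^ n ∈ K := by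
    rw [← hn, ← (hK P).symm.index_eq_card]
    exact K.pow_index_mem g
  intro H N _ hred
  have hle : K.subgroupOf H ≤ N := by
    have : (K.subgroupOf H).map (QuotientGroup.mk' N) ≤ pPrimeCore p (H ⧸ N) :=
      (isGreatest_pPrimeCore p _).2
        ⟨Normal.map inferInstance _ (QuotientGroup.mk'_surjective N),
        Nat.Coprime.coprime_dvd_left ((card_map_dvd _ _).trans
          (card_comap_dvd_of_injective _ _ H.subtype_injective)) hKp⟩
    rw [hred, le_bot_iff, Subgroup.map_eq_bot_iff, QuotientGroup.ker_mk'] at this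
    exact this
  rw [expOrderCount_ne_zero_iff]
  refine IsPGroup.exists_orderOf_eq_exponent (p := p) fun q => ?_
  obtain ⟨x, rfl⟩ := QuotientGroup.mk_surjective q
  refine ⟨n, (QuotientGroup.eq_one_iff _).2 (hle ?_)⟩
  exact hpow x

/-! ### Sylow subgroups and Frobenius' normal `p`-complement theorem -/

/-- A normal subgroup containing all `p'`-elements has `p`-power index, so it generates the group
together with any Sylow `p`-subgroup. -/
theorem Sylow.sup_eq_top_of_coprime_mem [Finite G] {C : Subgroup G} [C.Normal]
    (hC : ∀ x : G, (orderOf x).Coprime p → x ∈ C) (S : Sylow p G) : C ⊔ (S : Subgroup G) = ⊤ := by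
  have hquot : IsPGroup p (G ⧸ C) := by
    intro q
    obtain ⟨x, rfl⟩ := QuotientGroup.mk_surjective q
    obtain ⟨k, hk⟩ := exists_orderOf_pow_prime_pow_coprime (p := p) x
    exact ⟨k, (QuotientGroup.eq_one_iff _).2 (hC _ hk)⟩
  obtain ⟨n, hn⟩ := (IsPGroup.iff_card).1 hquot
  rw [← index_eq_one]
  refine Nat.eq_one_of_dvd_coprimes (Nat.Coprime.pow_left n
    (coprime_of_not_dvd S.not_dvd_index).symm) ?_ (index_dvd_of_le le_sup_right)
  rw [← hn, ← index_eq_card]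
  exact index_dvd_of_le le_sup_left

/-- A normal subgroup containing all `p'`-elements permutes the Sylow `p`-subgroups transitively. -/
theorem Sylow.exists_mem_smul_eq [Finite G] {C : Subgroup G} [C.Normal]
    (hC : ∀ x : G, (orderOf x).Coprime p → x ∈ C) (S T : Sylow p G) : ∃ c ∈ C, c • S = T := by
  obtain ⟨g, hg⟩ := MulAction.exists_smul_eq G S T
  obtain ⟨c, hc, s, hs, rfl⟩ := mem_sup_of_normal_left.1
    (S.sup_eq_top_of_coprime_mem hC ▸ mem_top g : g ∈ C ⊔ (S : Subgroup G))
  refine ⟨c, hc, ?_⟩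
  rw [← hg, mul_smul, Sylow.smul_eq_iff_mem_normalizer.2 (le_normalizer hs)]

/-- Normalizers grow in `p`-groups. -/
theorem IsPGroup.lt_inf_normalizer [Finite G] {P D : Subgroup G} (hP : IsPGroup p P) (hD : D < P) :
    D < P ⊓ normalizer (D : Set G) := by
  have := hP.isNilpotent
  have h := Group.normalizerCondition_of_isNilpotent (G := P) (D.subgroupOf P) (by
    rw [lt_top_iff_ne_top, Ne, subgroupOf_eq_top]
    exact hD.not_ge)
  rw [← subgroupOf_normalizer_eq hD.le] at h
  have := (map_lt_map_iff_of_injective P.subtype_injective).2 h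
  rwa [subgroupOf_map_subtype, subgroupOf_map_subtype, inf_eq_left.2 hD.le, inf_comm] at this

/-- Any two Sylow `p`-subgroups are conjugate by an element centralizing their intersection `D`. The
proof is by downward induction on `|D|`, passing through Sylow subgroups that contain `N_P(D)` and
`N_Q(D)`. -/
theorem PPrimeElementsCentralize.exists_centralizer_smul_eq [Finite G]
    (h : PPrimeElementsCentralize p G) (P Q : Sylow p G) :
    ∃ c ∈ centralizer ((P ⊓ Q : Subgroup G) : Set G), c • P = Q := by
  induction hn : Nat.card G - Nat.card (P ⊓ Q : Subgroup G) using Nat.strong_induction_on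
    generalizing P Q with
  | _ n ih =>
  subst hn
  set D : Subgroup G := P ⊓ Q
  by_cases hPQ : P = Q
  · exact ⟨1, one_mem _, by simpa⟩
  have hDP : D < P := inf_le_left.lt_of_ne fun e => hPQ (Sylow.ext
    (P.is_maximal' Q.2 (inf_eq_left.1 e)).symm)
  have hDQ : D < Q := inf_le_right.lt_of_ne fun e => hPQ (Sylow.ext
    (Q.is_maximal' P.2 (inf_eq_right.1 e)))
  have hcard {E : Subgroup G} (hE : D < E) :
      Nat.card G - Nat.card E < Nat.card G - Nat.card D := by
    have h1 : Nat.card D < Nat.card E := Set.ncard_lt_ncard hE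
    have h2 := Subgroup.card_le_card_group E
    omega
  set N := normalizer (D : Set G)
  obtain ⟨S, hS⟩ := (P.2.comap_subtype (K := N)).exists_le_sylow
  obtain ⟨T, hT⟩ := (Q.2.comap_subtype (K := N)).exists_le_sylow
  -- `N_P(D)` and `N_Q(D)` lie in Sylow subgroups of `N_G(D)`, conjugate under `C_G(D)`.
  obtain ⟨c, hc, hcST⟩ := Sylow.exists_mem_smul_eq
    (C := (centralizer (D : Set G)).subgroupOf N)
    (fun x hx => h D (P.2.to_inf_left) x x.2 (by rwa [orderOf_coe])) S T
  obtain ⟨R, hR⟩ := (S.2.map N.subtype).exists_le_sylow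
  have h1 : (P : Subgroup G) ⊓ N ≤ (P : Subgroup G) ⊓ R := le_inf inf_le_left (by
    rw [← subgroupOf_map_subtype]; exact (map_mono hS).trans hR)
  have h2 : (Q : Subgroup G) ⊓ N ≤ (((c : G) • R : Sylow p G) : Subgroup G) ⊓ Q := le_inf (by
    rintro x ⟨hxQ, hxN⟩
    have hx : (⟨x, hxN⟩ : N) ∈ c • S := hcST ▸ hT hxQ
    obtain ⟨s, hs, hsx⟩ := hx
    exact ⟨s, hR ⟨s, hs, rfl⟩, congrArg Subtype.val hsx⟩) inf_le_left
  have h3 := (P.2.lt_inf_normalizer hDP).trans_le h1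
  have h4 := (Q.2.lt_inf_normalizer hDQ).trans_le h2
  obtain ⟨a, ha, haR⟩ := ih _ (hcard h3) P R rfl
  obtain ⟨b, hb, hbQ⟩ := ih _ (hcard h4) ((c : G) • R) Q rfl
  refine ⟨b * (c * a), mul_mem (centralizer_le h4.le hb)
    (mul_mem hc (centralizer_le h3.le ha)), ?_⟩
  rw [mul_smul, mul_smul, haR, hbQ]

/-- A Sylow `p`-subgroup controls the fusion of its elements. -/
theorem PPrimeElementsCentralize.exists_mem_conj_eq [Finite G] (h : PPrimeElementsCentralize p G)
    (P : Sylow p G) {x g : G} (hx : x ∈ P) (hg : g * x * g⁻¹ ∈ P) :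
    ∃ w ∈ P, g * x * g⁻¹ = w * x * w⁻¹ := by
  obtain ⟨c, hc, hcP⟩ := h.exists_centralizer_smul_eq P (g⁻¹ • P)
  have hxc : x * c = c * x := (mem_centralizer_iff.1 hc) x
    ⟨hx, ⟨g * x * g⁻¹, hg, by simp [mul_assoc]⟩⟩
  have hn : g * c ∈ normalizer (P : Set G) := by
    rw [← Sylow.smul_eq_iff_mem_normalizer, mul_smul, hcP, smul_inv_smul]
  set N := normalizer (P : Set G)
  -- `N_G(P) = C_G(P) P`.
  have htop := (P.subtype le_normalizer).sup_eq_top_of_coprime_mem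
    (C := (centralizer (P : Set G)).subgroupOf N)
    (fun x hx => h P P.2 x x.2 (by rwa [orderOf_coe]))
  rw [sup_comm] at htop
  obtain ⟨⟨w, hwN⟩, hw, ⟨d, hdN⟩, hd, e⟩ :=
    mem_sup_of_normal_right.1 (htop ▸ mem_top (⟨g * c, hn⟩ : N))
  replace e : w * d = g * c := congrArg Subtype.val e
  refine ⟨w, hw, ?_⟩
  have hxd : x * d = d * x := (mem_centralizer_iff.1 hd) x hx
  have e' : g = w * d * c⁻¹ := by rw [e]; group
  rw [e']
  have : d * (c⁻¹ * x * c) * d⁻¹ = x := by rw [mul_assoc c⁻¹, hxc]; simp [← hxd]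
  calc _ = w * (d * (c⁻¹ * x * c) * d⁻¹) * w⁻¹ := by group
    _ = _ := by rw [this]

open scoped commutatorElement in
/-- As `P` controls the fusion of its elements, its focal subgroup is no larger than its
commutator subgroup. -/
theorem PPrimeElementsCentralize.focalSubgroupOf_eq [Finite G] (h : PPrimeElementsCentralize p G)
    (P : Sylow p G) : (P : Subgroup G).focalSubgroupOf = _root_.commutator P := by
  refine le_antisymm ?_ (commutator_le_focalSubgroupOf _)
  rw [focalSubgroupOf_eq_closure, closure_le]
  rintro a ⟨x, hx, u, ha⟩
  have hu : u * x⁻¹ * u⁻¹ ∈ P := by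
    have : u * x⁻¹ * u⁻¹ = x⁻¹ * a := by rw [ha, commutatorElement_def]; group
    exact this ▸ mul_mem (inv_mem hx) a.2
  obtain ⟨w, hw, e⟩ := h.exists_mem_conj_eq P (inv_mem hx) hu
  have : a = ⁅(⟨x, hx⟩ : P), ⟨w, hw⟩⁆ := by
    apply Subtype.ext
    rw [ha, commutatorElement_def]
    calc x * u * x⁻¹ * u⁻¹ = x * (u * x⁻¹ * u⁻¹) := by group
      _ = x * (w * x⁻¹ * w⁻¹) := by rw [e]
      _ = x * w * x⁻¹ * w⁻¹ := by group
  rw [this]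
  exact commutator_mem_commutator (mem_top _) (mem_top _)

/-- **Frobenius' normal `p`-complement theorem**, with the complement described as a normal
subgroup of order prime to `p` and `p`-power index. -/
theorem PPrimeElementsCentralize.exists_normal_coprime {G : Type*} [Group G] [Finite G]
    (h : PPrimeElementsCentralize p G) :
    ∃ K : Subgroup G, K.Normal ∧ (Nat.card K).Coprime p ∧ ∀ g : G, ∃ k, g ^ p ^ k ∈ K := by
  induction hn : Nat.card G using Nat.strong_induction_on generalizing G with
  | _ n ih =>
  subst hn
  obtain ⟨P⟩ : Nonempty (Sylow p G) := inferInstance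
  rcases subsingleton_or_nontrivial P with hP | hP
  · refine ⟨⊤, inferInstance, ?_, fun g => ⟨0, mem_top _⟩⟩
    have hbot : (P : Subgroup G) = ⊥ := (eq_bot_iff_forall _).2 fun x hx =>
      congrArg Subtype.val (Subsingleton.elim (⟨x, hx⟩ : P) 1)
    have := P.not_dvd_index
    rw [hbot, index_bot] at this
    rw [card_top]
    exact coprime_of_not_dvd this
  -- The transfer into `P ⧸ [P, P]` is onto, so its kernel is a proper subgroup of `p`-power index.
  set N := (P : Subgroup G).transferFocal.ker
  have hnil := P.2.isNilpotent
  have hlt : Nat.card N < Nat.card G := by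
    refine lt_of_le_of_ne (card_le_card_group N) fun e => ?_
    have htop : N = ⊤ := (card_eq_iff_eq_top N).1 e
    have := Group.IsSolvable.commutator_lt_top_of_nontrivial P
    rw [← h.focalSubgroupOf_eq P] at this
    refine this.not_ge fun x _ => ?_
    obtain ⟨g, hg⟩ := transferFocal_surjective P (QuotientGroup.mk x)
    rw [← QuotientGroup.eq_one_iff, ← hg]
    exact (htop ▸ mem_top g : g ∈ N)
  obtain ⟨K, -, hKp, hK⟩ := ih _ hlt (h.of_injective N.subtype N.subtype_injective) rfl
  -- `K` consists of the `p'`-elements of `N`, so it is normal in `G`.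
  have hmem (x : G) : x ∈ K.map N.subtype ↔ x ∈ N ∧ (orderOf x).Coprime p := by
    constructor
    · rintro ⟨y, hy, rfl⟩
      refine ⟨y.2, Nat.Coprime.coprime_dvd_left ?_ hKp⟩
      rw [coe_subtype, orderOf_coe]
      exact orderOf_dvd_natCard K hy
    · rintro ⟨hx, hxp⟩
      obtain ⟨k, hk⟩ := hK ⟨x, hx⟩
      exact ⟨⟨x, hx⟩, mem_of_pow_prime_pow_mem (by rwa [orderOf_mk]) hk, rfl⟩
  refine ⟨K.map N.subtype, ⟨fun x hx g => ?_⟩, ?_, fun g => ?_⟩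
  · rw [hmem] at hx ⊢
    refine ⟨(MonoidHom.normal_ker _).conj_mem x hx.1 g, ?_⟩
    rw [← MulAut.conj_apply, MulEquiv.orderOf_eq]
    exact hx.2
  · rwa [card_map_of_injective N.subtype_injective]
  · obtain ⟨k, hk⟩ := P.2.to_quotient _ (transferFocal (P : Subgroup G) g)
    rw [← map_pow] at hk
    obtain ⟨l, hl⟩ := hK ⟨g ^ p ^ k, hk⟩
    refine ⟨k + l, ⟨_, hl, ?_⟩⟩
    simp [pow_add, pow_mul]

theorem PPrimeElementsCentralize.isPNilpotent [Finite G] (h : PPrimeElementsCentralize p G) :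
    IsPNilpotent p G := by
  obtain ⟨K, hKn, hKp, hK⟩ := h.exists_normal_coprime
  refine ⟨K, hKn, fun P => isComplement'_of_disjoint_and_mul_eq_univ ?_ ?_⟩
  · obtain ⟨n, hn⟩ := IsPGroup.iff_card.1 P.2
    exact disjoint_of_coprime_natCard (hn ▸ hKp.pow_right n)
  · rw [← normal_mul, P.sup_eq_top_of_coprime_mem fun x hx => ?_, coe_top]
    obtain ⟨k, hk⟩ := hK x
    exact mem_of_pow_prime_pow_mem hx hk

/-! ### From sections to the local condition -/

/-- If every `p'`-reduced section attains its exponent, no `p'`-element acts nontrivially on a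
`p`-subgroup. -/
theorem ReducedSectionsAttainExponent.pPrimeElementsCentralize {G : Type*} [Group G] [Finite G]
    (h : ReducedSectionsAttainExponent p G) : PPrimeElementsCentralize p G := by
  induction hn : Nat.card G using Nat.strong_induction_on generalizing G with
  | _ n ih =>
  subst hn
  intro Q hQ x hx hxp
  by_contra hcent
  -- Minimality of `G`, applied to its proper subgroups and its proper quotients.
  have hsub {H M : Subgroup G} (hH : H ≠ ⊤) (hM : IsPGroup p M) (hMH : M ≤ H) (hxH : x ∈ H)
      (hxM : x ∈ normalizer (M : Set G)) : x ∈ centralizer (M : Set G) := by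
    have h1 := ih _ (lt_of_le_of_ne (card_le_card_group H) fun e => hH ((card_eq_iff_eq_top H).1 e))
      (h.of_injective H.subtype H.subtype_injective) rfl (M.subgroupOf H) hM.comap_subtype ⟨x, hxH⟩
      (by rw [← subgroupOf_normalizer_eq hMH]; exact hxM) (by rwa [orderOf_mk])
    rw [mem_centralizer_iff] at h1 ⊢
    intro y hy
    exact congrArg Subtype.val (h1 ⟨y, hMH hy⟩ hy)
  have hquot {L : Subgroup G} [L.Normal] (hL : L ≠ ⊥) {y : G} (hy : y ∈ Q) :
      x * y * x⁻¹ * y⁻¹ ∈ L := by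
    have hlt : Nat.card (G ⧸ L) < Nat.card G := by
      rw [card_eq_card_quotient_mul_card_subgroup L]
      exact lt_mul_of_one_lt_right Nat.card_pos ((one_lt_card_iff_ne_bot L).2 hL)
    have h1 := ih _ hlt (h.of_surjective (QuotientGroup.mk' L) (QuotientGroup.mk'_surjective L)) rfl
      (Q.map (QuotientGroup.mk' L)) (hQ.map _) (QuotientGroup.mk' L x)
      (le_normalizer_map _ ⟨x, hx, rfl⟩) (hxp.coprime_dvd_left (orderOf_map_dvd _ x))
    have h2 := mem_centralizer_iff.1 h1 (QuotientGroup.mk' L y) ⟨y, hy, rfl⟩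
    rw [← QuotientGroup.eq_one_iff]
    change QuotientGroup.mk' L (x * y * x⁻¹ * y⁻¹) = 1
    rw [map_mul, map_mul, map_mul, map_inv, map_inv, ← h2]
    group
  have hcomm {y : G} (hxy : x * y * x⁻¹ * y⁻¹ = 1) : y * x = x * y := by
    rw [mul_inv_eq_one, mul_inv_eq_iff_eq_mul] at hxy
    exact hxy.symm
  have htop : Q ⊔ zpowers x = ⊤ := by
    by_contra hne
    exact hcent (hsub hne hQ le_sup_left (mem_sup_right (mem_zpowers x)) hx)
  have hQn : Q.Normal := by
    rw [← normalizer_eq_top_iff, ← top_le_iff, ← htop]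
    exact sup_le le_normalizer (zpowers_le.2 hx)
  -- If `M < Q` is normal and nontrivial, `x` centralizes `M` and `Q ⧸ M`, hence `Q`, since `x` has
  -- order prime to `p`.
  have hmin {M : Subgroup G} [M.Normal] (hMQ : M ≤ Q) (hM : M ≠ ⊥) : M = Q := by
    by_contra hne
    have hMx : M ⊔ zpowers x ≠ ⊤ := by
      refine fun e => hne (le_antisymm hMQ fun y hy => ?_)
      obtain ⟨m, hm, z, hz, rfl⟩ := mem_sup_of_normal_left.1 (e ▸ mem_top y : y ∈ M ⊔ zpowers x)
      have hz1 : z = 1 := eq_one_of_isPGroup_of_coprime hQ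
        ((Q.mul_mem_cancel_left (hMQ hm)).1 hy)
        (hxp.coprime_dvd_left (orderOf_dvd_of_mem_zpowers hz))
      rwa [hz1, mul_one]
    have hxM := mem_centralizer_iff.1 (hsub hMx (hQ.to_le hMQ) le_sup_left
      (mem_sup_right (mem_zpowers x)) (normalizer_eq_top M ▸ mem_top x))
    refine hcent (mem_centralizer_iff.2 fun y hy => hcomm ?_)
    have hmM : x * y * x⁻¹ * y⁻¹ ∈ M := hquot hM hy
    set m := x * y * x⁻¹ * y⁻¹ with hmdef
    have hxm : m * x = x * m := hxM m hmM
    -- `x` acts on `y` as multiplication by `m`, which `x` fixes.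
    have hpow (n : ℕ) : x ^ n * y = m ^ n * y * x ^ n := by
      have hxy : x * y = m * y * x := by rw [hmdef]; group
      have hc (n : ℕ) : x * m ^ n = m ^ n * x :=
        ((show Commute x m from hxm.symm).pow_right n)
      induction n with
      | zero => simp
      | succ n ihn =>
        calc x ^ (n + 1) * y = x * (x ^ n * y) := by rw [pow_succ', mul_assoc]
          _ = (x * m ^ n) * y * x ^ n := by rw [ihn]; group
          _ = m ^ n * (x * y) * x ^ n := by rw [hc]; group
          _ = m ^ n * (m * y * x) * x ^ n := by rw [hxy]
          _ = m ^ (n + 1) * y * x ^ (n + 1) := by rw [pow_succ, pow_succ' x]; group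
    have hm1 : m ^ orderOf x = 1 := by
      have := hpow (orderOf x)
      rw [pow_orderOf_eq_one, one_mul, mul_one] at this
      exact right_eq_mul.1 this
    exact eq_one_of_isPGroup_of_coprime hQ (hMQ hmM)
      (hxp.coprime_dvd_left (orderOf_dvd_of_pow_eq_one hm1))
  -- For a nontrivial `L` of order prime to `p`, normality gives `[Q, x] ≤ Q ⊓ L = ⊥`.
  have hred : IsPPrimeReduced p G := by
    by_contra hne
    obtain ⟨hLn, hLp⟩ := (isGreatest_pPrimeCore p G).1
    refine hcent (mem_centralizer_iff.2 fun y hy => hcomm ?_)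
    have hL := hquot hne hy
    exact eq_one_of_isPGroup_of_coprime hQ (mul_mem (hQn.conj_mem y hy x) (inv_mem hy))
      (hLp.coprime_dvd_left (orderOf_dvd_natCard _ hL))
  obtain ⟨y, hyQ, hy1⟩ : ∃ y ∈ Q, y ≠ 1 := by
    by_contra! hall
    exact hcent (mem_centralizer_iff.2 fun y hy => by rw [hall y hy, one_mul, mul_one])
  have hQab : Q ≤ centralizer (Q : Set G) := by
    have : Nontrivial Q := ⟨⟨y, hyQ⟩, 1, fun e => hy1 (congrArg Subtype.val e)⟩
    have := hQ.center_nontrivial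
    obtain ⟨z, hz⟩ := exists_ne (1 : center Q)
    have hne : Q ⊓ centralizer (Q : Set G) ≠ ⊥ := fun e => hz (by
      ext
      refine (mem_bot.1 (e ▸ ⟨z.1.2, mem_centralizer_iff.2 fun w hw => ?_⟩ :
        ((z : Q) : G) ∈ (⊥ : Subgroup G)))
      exact congrArg Subtype.val (mem_center_iff.1 z.2 ⟨w, hw⟩))
    exact inf_eq_left.1 (hmin inf_le_left hne)
  obtain ⟨g, hg⟩ := expOrderCount_ne_zero_iff.1 (h.of_surjective_subgroup (H := ⊤)
    (topEquiv (G := G)).toMonoidHom topEquiv.surjective hred)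
  -- `g ^ p ^ k` and `g ^ m` generate the `p'`-part and the `p`-part of `⟨g⟩`.
  obtain ⟨k, m, hm, hkm⟩ := Nat.exists_eq_pow_mul_and_not_dvd (orderOf_pos g).ne' p hp.out.ne_one
  have hm0 : m ≠ 0 := fun e => hm (e ▸ dvd_zero p)
  have hb : orderOf (g ^ p ^ k) = m := by
    rw [orderOf_pow_of_dvd (pow_ne_zero _ hp.out.ne_zero) (hkm ▸ dvd_mul_right _ _), hkm,
      Nat.mul_div_cancel_left _ (pow_pos hp.out.pos k)]
  have hc : orderOf (g ^ m) = p ^ k := by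
    rw [orderOf_pow_of_dvd hm0 (hkm ▸ dvd_mul_left _ _), hkm,
      Nat.mul_div_cancel _ (Nat.pos_of_ne_zero hm0)]
  have hk : k ≠ 0 := by
    rintro rfl
    have h1 : p ∣ orderOf y := by
      rw [← orderOf_mk y hyQ]
      exact hQ.dvd_orderOf fun e => hy1 (congrArg Subtype.val e)
    have h2 := h1.trans ((Monoid.order_dvd_exponent y).trans hg.symm.dvd)
    rw [hkm, pow_zero, one_mul] at h2
    exact hm h2
  have hindex : Q.index ∣ orderOf x := by
    rw [← relIndex_top_right, ← htop, sup_comm, relIndex_sup_right, ← Nat.card_zpowers]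
    exact relIndex_dvd_card _ _
  have hcQ : g ^ m ∈ Q := by
    have h1 : g ^ m ∈ zpowers ((g ^ m) ^ Q.index) := by
      rw [mem_zpowers_pow_iff, hc]
      exact (hxp.coprime_dvd_left hindex).pow_right k
    exact zpowers_le.2 (Q.pow_index_mem (g ^ m)) h1
  have hxm : orderOf x ∣ m := by
    have h1 := (Monoid.order_dvd_exponent x).trans hg.symm.dvd
    rw [hkm] at h1
    exact (hxp.pow_right k).dvd_of_dvd_mul_left h1
  -- Both sides have order `|Q| |x|`, because `|x|` divides `exp G` and hence `m`.
  have hgtop : Q ⊔ zpowers (g ^ p ^ k) = ⊤ := by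
    rw [← card_eq_iff_eq_top]
    refine Nat.dvd_antisymm (card_subgroup_dvd_card _) ?_
    obtain ⟨j, hj⟩ := IsPGroup.iff_card.1 hQ
    rw [← card_mul_index Q]
    refine (mul_dvd_mul_left _ hindex).trans (Nat.Coprime.mul_dvd_of_dvd_of_dvd ?_
      (card_dvd_of_le le_sup_left) ?_)
    · rw [hj]; exact (hxp.pow_right j).symm
    · refine (hxm.trans ?_).trans (card_dvd_of_le le_sup_right)
      rw [Nat.card_zpowers, hb]
  have hcZ : g ^ m ∈ center G := by
    have hle : Q ⊔ zpowers (g ^ p ^ k) ≤ centralizer {g ^ m} := by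
      refine sup_le (hQab.trans (centralizer_le (Set.singleton_subset_iff.2 hcQ))) ?_
      rw [zpowers_le, mem_centralizer_singleton_iff]
      exact ((Commute.refl g).pow_pow _ _).eq
    rw [hgtop] at hle
    exact mem_center_iff.2 fun z => mem_centralizer_singleton_iff.1 (hle (mem_top z))
  have hQZ : Q ⊓ center G = Q := hmin inf_le_left fun e => by
    have h1 : g ^ m = 1 := mem_bot.1 (e ▸ ⟨hcQ, hcZ⟩ : g ^ m ∈ (⊥ : Subgroup G))
    rw [h1, orderOf_one] at hc
    exact (Nat.one_lt_pow hk hp.out.one_lt).ne hc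
  exact hcent (mem_centralizer_iff.2 fun y hy => (mem_center_iff.1 (inf_eq_left.1 hQZ hy) x).symm)

/-! ### Reduction to centric radical subgroups -/

/-- It suffices to test the condition on the `p`-subgroups which are `p`-centric and `p`-radical. -/
theorem PPrimeElementsCentralize.of_centric_radical [Finite G]
    (h : ∀ Q : Subgroup G, IsPGroup p Q → IsPCentricSubgroup p Q → IsPRadicalSubgroup p Q →
      PPrimeElementsCentralize p (normalizer (Q : Set G))) : PPrimeElementsCentralize p G := by
  intro Q
  induction hn : Nat.card G - Nat.card Q using Nat.strong_induction_on generalizing Q with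
  | _ n ih =>
  subst hn
  intro hQ x hx hxp
  replace ih {R : Subgroup G} (hQR : Q < R) (hR : IsPGroup p R) {y : G}
      (hy : y ∈ normalizer (R : Set G)) (hyp : (orderOf y).Coprime p) :
      y ∈ centralizer (Q : Set G) := by
    have h1 : Nat.card Q < Nat.card R := Set.ncard_lt_ncard hQR
    have h2 := card_le_card_group R
    exact centralizer_le hQR.le (ih _ (by omega) R rfl hR y hy hyp)
  let N := normalizer (Q : Set G)
  set C := centralizer (Q : Set G)
  by_cases hcen : IsPCentricSubgroup p Q
  · by_cases hrad : IsPRadicalSubgroup p Q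
    · have h1 := h Q hQ hcen hrad (Q.subgroupOf N) hQ.comap_subtype ⟨x, hx⟩
        ((normalizer_eq_top (Q.subgroupOf N)).symm ▸ mem_top _) (by rwa [orderOf_mk])
      rw [mem_centralizer_iff] at h1 ⊢
      intro y hy
      exact congrArg Subtype.val (h1 ⟨y, le_normalizer hy⟩ hy)
    · -- The preimage of `O_p(N_G(Q) ⧸ Q)` is a larger `p`-subgroup normalized by `x`.
      obtain ⟨hOn, hOp⟩ := (isGreatest_pCore p (N ⧸ Q.subgroupOf N)).1
      set O := (pCore p (N ⧸ Q.subgroupOf N)).comap (QuotientGroup.mk' (Q.subgroupOf N)) with hO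
      have hOpg : IsPGroup p O := hOp.comap_of_ker_isPGroup _ (by
        rw [QuotientGroup.ker_mk']; exact hQ.comap_subtype)
      have hQO : Q.subgroupOf N < O := by
        refine lt_of_le_of_ne ?_ fun e => hrad ?_
        · exact (QuotientGroup.ker_mk' (Q.subgroupOf N)).symm.le.trans (MonoidHom.ker_le_comap _ _)
        · rw [IsPRadicalSubgroup, IsPReduced,
            ← map_comap_eq_self_of_surjective (QuotientGroup.mk'_surjective (Q.subgroupOf N))
              (pCore p (N ⧸ Q.subgroupOf N)), ← hO, ← e, Subgroup.map_eq_bot_iff,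
            QuotientGroup.ker_mk']
      refine ih (R := O.map N.subtype) ?_ (hOpg.map _) ?_ hxp
      · have := (map_lt_map_iff_of_injective N.subtype_injective).2 hQO
        rwa [subgroupOf_map_subtype, inf_eq_left.2 le_normalizer] at this
      · have hOn' : O.Normal := hOn.comap _
        exact le_normalizer_map N.subtype ⟨⟨x, hx⟩, by rw [normalizer_eq_top]; exact mem_top _, rfl⟩
  · obtain ⟨P⟩ : Nonempty (Sylow p C) := inferInstance
    set R := (P : Subgroup C).map C.subtype
    have hRC : R ≤ C := map_subtype_le _
    -- If `R ≤ Q` then `R = Z(Q)`, so that `Q` is `p`-centric.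
    have hlt : Q < Q ⊔ R := by
      refine left_lt_sup.2 fun hle => hcen ⟨P, ?_⟩
      refine (P.is_maximal' ?_ ?_).symm
      · exact (hQ.to_subgroup (center Q)).map Q.subtype |>.comap_subtype
      · intro c hc
        have hcQ : (c : G) ∈ Q := hle ⟨c, hc, rfl⟩
        exact ⟨⟨c, hcQ⟩, mem_center_iff.2 fun q => Subtype.ext (mem_centralizer_iff.1 c.2 q q.2), rfl⟩
    have hCN : C ≤ N := centralizer_le_normalizer _
    have hsup : IsPGroup p (Q ⊔ R : Subgroup G) :=
      hQ.to_sup_of_normal_left' (P.2.map _) (hRC.trans hCN)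
    -- The Frattini argument: some element of the coset `C_G(Q) x` normalizes `R`.
    obtain ⟨y, hyC, hyP⟩ : ∃ y ∈ C, y * x ∈ normalizer (R : Set G) := by
      have hxC : x ∈ normalizer (C : Set G) :=
        le_normalizer_of_normal_subgroupOf (K := N) hCN hx
      obtain ⟨c, hc⟩ := MulAction.exists_smul_eq C (C.normalizerMonoidHom ⟨x, hxC⟩ • P) P
      refine ⟨c, c.2, mem_normalizer_fintype ?_⟩
      rintro _ ⟨z, hz, rfl⟩
      refine ⟨c * (C.normalizerMonoidHom ⟨x, hxC⟩ z) * c⁻¹, ?_, ?_⟩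
      · have : MulAut.conj c (C.normalizerMonoidHom ⟨x, hxC⟩ z) ∈
            c • C.normalizerMonoidHom ⟨x, hxC⟩ • P := ⟨_, ⟨z, hz, rfl⟩, rfl⟩
        rw [hc] at this
        exact this
      · change (c : G) * (x * z * x⁻¹) * (c : G)⁻¹ = c * x * z * (c * x)⁻¹
        group
    have hyN : y * x ∈ N := mul_mem (hCN hyC) hx
    obtain ⟨k, hk⟩ := exists_orderOf_pow_prime_pow_coprime (p := p) (y * x)
    have hyQP : y * x ∈ normalizer ((Q ⊔ R : Subgroup G) : Set G) := by
      rw [mem_normalizer_iff_map_conj_eq, Subgroup.map_sup, mem_normalizer_iff_map_conj_eq.1 hyN,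
        mem_normalizer_iff_map_conj_eq.1 hyP]
    have h1 : (y * x) ^ p ^ k ∈ C := ih hlt hsup (pow_mem hyQP _) hk
    refine mem_of_pow_prime_pow_mem hxp (k := k) ?_
    -- `y * x` and `x` agree modulo `C_G(Q)`.
    let π := QuotientGroup.mk' (C.subgroupOf N)
    have hy : π ⟨y, hCN hyC⟩ = 1 := (QuotientGroup.eq_one_iff _).2 hyC
    have hyx : π ⟨y * x, hyN⟩ = π ⟨x, hx⟩ := by
      rw [← one_mul (π ⟨x, hx⟩), ← hy, ← map_mul]
      rfl
    have h2 : π (⟨y * x, hyN⟩ ^ p ^ k) = 1 := (QuotientGroup.eq_one_iff _).2 h1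
    rw [map_pow, hyx, ← map_pow] at h2
    exact (QuotientGroup.eq_one_iff (N := C.subgroupOf N) _).1 h2

end

theorem theorem1p1 (G : Type*) [Group G] [Finite G] (p : ℕ) [Fact p.Prime] :
    List.TFAE [
      IsPNilpotent p G,
      ReducedSectionsAttainExponent p G,
      ∀ Q : Subgroup G, IsPGroup p Q → IsPCentricSubgroup p Q →
        ReducedSectionsAttainExponent p (Subgroup.normalizer (Q : Set G)),
      ∀ Q : Subgroup G, IsPGroup p Q → IsPCentricSubgroup p Q → IsPRadicalSubgroup p Q →
        ReducedSectionsAttainExponent p (Subgroup.normalizer (Q : Set G))] := by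
  tfae_have 1 → 2 := IsPNilpotent.reducedSectionsAttainExponent
  tfae_have 2 → 3 := fun h Q _ _ => h.of_injective _ (Subgroup.subtype_injective _)
  tfae_have 3 → 4 := fun h Q hQ hc _ => h Q hQ hc
  tfae_have 4 → 1 := fun h => (PPrimeElementsCentralize.of_centric_radical fun Q hQ hc hr =>
    (h Q hQ hc hr).pPrimeElementsCentralize).isPNilpotent
  tfae_finish
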